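/- Let $F_2\times\mathbb Z$ be the direct product of the free group on $x,y$ and the infinite cyclic group generated by $z$. A left order on a group $G$ is a strict total order $\prec$ on $G$ such that $g\prec h\iff fg\prec fh$ for all $f,g,h\in G$; its positive cone is $\{g\in G: g\succ 1\}$. For a subset $S$ of a group, $\langle S\rangle^+$ denotes the subsemigroup generated by $S$. (1) There is a left order on $F_2\times\mathbb Z$ whose positive cone is finitely generated as a semigroup; more precisely, there is one whose positive cone is the subsemigroup generated by the seven pairwise distinct elements $$x,\quad yxz^{-1},\quad x^{-1}yxz^{-1},\quad x^{-1}y^{-1}x^{-1}yx,\quad x^{-1}y^{-1}z^2,\quad x^{-1}y^{-1}xz^2,\quad y^{-1}x^{-1}yxz^{-1}.$$ (2) This cone is realised as follows. Let $\Gamma_2=\langle a,b : ba^2b=a\rangle$; it is isomorphic to the braid group $B_3=\langle\sigma_1,\sigma_2:\sigma_1\sigma_2\sigma_1=\sigma_2\sigma_1\sigma_2\rangle$ by $a\mapsto\sigma_1\sigma_2$, $b\mapsto\sigma_2^{-1}$. Let $\varphi:\Gamma_2\to\mathbb Z/6\mathbb Z$ be the homomorphism with $\varphi(a)=4$, $\varphi(b)=1$,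 and let $H=\ker\varphi$. Then $H$ has index $6$ in $\Gamma_2$, and $H$ is generated as a group by $ab^2,\ a^2b^2a^2,\ a^3$. There is a left order on $H$ whose positive cone equals both $H\cap\langle a,b\rangle^+$ and the subsemigroup generated by the seven elements $$ab^2,\quad b^{-1}ab^3,\quad b^{-2}ab^4,\quad b^{-3}ab^5,\quad b^{-4}a,\quad b^{-5}ab,\quad b^6.$$ Moreover there is an isomorphism $\psi:H\to F_2\times\mathbb Z$ with $\psi(ab^2)=x$, $\psi(a^2b^2a^2)=y$, $\psi(a^3)=z$, and $\psi$ maps these seven elements, in the order listed, to the seven elements in (1), in the order listed. -/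

import Mathlib

namespace LeftOrderF2Z

/-- A left order on a group: a strict total order `r` on the elements such that
`g ≺ h` if and only if `f g ≺ f h`. -/
structure IsLeftOrder {G : Type*} [Group G] (r : G → G → Prop) : Prop where
  strictTotal : IsStrictTotalOrder G r
  mul_left_iff : ∀ f g h : G, r g h ↔ r (f * g) (f * h)

/-- The positive cone of an order: the set of elements greater than the identity. -/
def positiveCone {G : Type*} [Group G] (r : G → G → Prop) : Set G := {g | r 1 g}

/-- The single relator `b a² b a⁻¹` on the free generators `a = of 0`, `b = of 1`. -/
def gammaRels : Set (FreeGroup (Fin 2)) :=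
  {FreeGroup.of 1 * FreeGroup.of 0 ^ 2 * FreeGroup.of 1 * (FreeGroup.of 0)⁻¹}

/-- The group `Γ₂ = ⟨a, b | b a² b = a⟩`. -/
abbrev Gamma : Type := PresentedGroup gammaRels

/-- The generator `a` of `Γ₂`. -/
def a : Gamma := PresentedGroup.of 0

/-- The generator `b` of `Γ₂`. -/
def b : Gamma := PresentedGroup.of 1

/-- The single braid relator `σ₁ σ₂ σ₁ (σ₂ σ₁ σ₂)⁻¹`, with `σ₁ = of 0`, `σ₂ = of 1`. -/
def braidRels : Set (FreeGroup (Fin 2)) :=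
  {FreeGroup.of 0 * FreeGroup.of 1 * FreeGroup.of 0 *
    (FreeGroup.of 1 * FreeGroup.of 0 * FreeGroup.of 1)⁻¹}

/-- The braid group on three strands, `B₃ = ⟨σ₁, σ₂ | σ₁ σ₂ σ₁ = σ₂ σ₁ σ₂⟩`. -/
abbrev B3 : Type := PresentedGroup braidRels

/-- The generator `σ₁` of `B₃`. -/
def σ₁ : B3 := PresentedGroup.of 0

/-- The generator `σ₂` of `B₃`. -/
def σ₂ : B3 := PresentedGroup.of 1

/-- The values `4, 1 ∈ ℤ/6ℤ` (written multiplicatively) taken by `φ` on `a, b`. -/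
def phiGen : Fin 2 → Multiplicative (ZMod 6) :=
  ![Multiplicative.ofAdd 4, Multiplicative.ofAdd 1]

theorem phiGen_rels : ∀ w ∈ gammaRels, FreeGroup.lift phiGen w = 1 := by
  rintro w rfl
  simp only [map_mul, map_pow, map_inv, FreeGroup.lift_apply_of]
  decide

/-- The homomorphism `φ : Γ₂ → ℤ/6ℤ` with `φ(a) = 4` and `φ(b) = 1`. -/
def phi : Gamma →* Multiplicative (ZMod 6) := PresentedGroup.toGroup phiGen_rels

theorem phi_a : phi a = Multiplicative.ofAdd 4 := PresentedGroup.toGroup.of phiGen_rels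

theorem phi_b : phi b = Multiplicative.ofAdd 1 := PresentedGroup.toGroup.of phiGen_rels

/-- The kernel of `φ`. -/
def H : Subgroup Gamma := phi.ker

/-- The three elements `a b²`, `a² b² a²`, `a³` of `Γ₂`. -/
def genGamma : Fin 3 → Gamma := ![a * b ^ 2, a ^ 2 * b ^ 2 * a ^ 2, a ^ 3]

/-- The seven elements
`a b², b⁻¹ a b³, b⁻² a b⁴, b⁻³ a b⁵, b⁻⁴ a, b⁻⁵ a b, b⁶` of `Γ₂`. -/
def coneGamma : Fin 7 → Gamma :=
  ![a * b ^ 2,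
    b⁻¹ * a * b ^ 3,
    (b ^ 2)⁻¹ * a * b ^ 4,
    (b ^ 3)⁻¹ * a * b ^ 5,
    (b ^ 4)⁻¹ * a,
    (b ^ 5)⁻¹ * a * b,
    b ^ 6]

theorem genGamma_mem (i : Fin 3) : genGamma i ∈ H := by
  rw [H, MonoidHom.mem_ker]
  fin_cases i <;> simp [genGamma, phi_a, phi_b] <;> decide

theorem coneGamma_mem (i : Fin 7) : coneGamma i ∈ H := by
  rw [H, MonoidHom.mem_ker]
  fin_cases i <;> simp [coneGamma, phi_a, phi_b] <;> decide

/-- `a b²`, `a² b² a²`, `a³` as elements of `H`. -/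
def genH (i : Fin 3) : H := ⟨genGamma i, genGamma_mem i⟩

/-- The seven elements of `coneGamma` as elements of `H`. -/
def coneH (i : Fin 7) : H := ⟨coneGamma i, coneGamma_mem i⟩

/-- The group `F₂ × ℤ` (the factor `ℤ` is written multiplicatively). -/
abbrev F2Z : Type := FreeGroup (Fin 2) × Multiplicative ℤ

/-- The first free generator of `F₂`, in `F₂ × ℤ`. -/
def x : F2Z := (FreeGroup.of 0, 1)

/-- The second free generator of `F₂`, in `F₂ × ℤ`. -/
def y : F2Z := (FreeGroup.of 1, 1)

/-- The generator `1` of `ℤ`, in `F₂ × ℤ`. -/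
def z : F2Z := (1, Multiplicative.ofAdd 1)

/-- The seven elements `x`, `y x z⁻¹`, `x⁻¹ y x z⁻¹`, `x⁻¹ y⁻¹ x⁻¹ y x`, `x⁻¹ y⁻¹ z²`,
`x⁻¹ y⁻¹ x z²`, `y⁻¹ x⁻¹ y x z⁻¹` of `F₂ × ℤ`. -/
def coneF2Z : Fin 7 → F2Z :=
  ![x,
    y * x * z⁻¹,
    x⁻¹ * y * x * z⁻¹,
    x⁻¹ * y⁻¹ * x⁻¹ * y * x,
    x⁻¹ * y⁻¹ * z ^ 2,
    x⁻¹ * y⁻¹ * x * z ^ 2,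
    y⁻¹ * x⁻¹ * y * x * z⁻¹]

end LeftOrderF2Z

namespace LeftOrderF2Z

/-! A subsemigroup P with 1 ∉ P and G = {1} ∪ P ∪ P⁻¹ is a positive cone, so everything reduces to
these two facts for ⟨a, b⟩⁺ in Γ₂. Totality: a³ = (ba²)² is central, which gives each element a
normal form aᵏ w aᵉ with w a word in b and ba; its sign can then be read off
(`mem_positive_or_inv_mem`). Strictness: Γ₂ acts on a cover of the projective line so that no
positive word other than a power of b fixes a base point, and powers of b are detected by
abelianizing (`eq_one_of_inv_mem`). The cone restricts to H. Reading a positive word while keeping a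
coset representative b⁻ⁱ, 0 ≤ i < 6, splits it into the seven generators, all positive because b⁻¹a
= a²b (`exists_coset_rep`, `conj_mem_cone`). Finally, x = ab² and u = axa⁻¹ generate a free group
normalised by b, and y = ua³. Conjugating by b rewrites the seven elements in x, u, a³
(`toH_coneF2Z`); mapping Γ₂ to F₂ ⋊ ℤ shows that there are no hidden relations (`toH_injective`). -/

theorem exists_leftOrder {G : Type*} [Group G] (P : Subsemigroup G) (h1 : (1 : G) ∉ P)
    (hP : ∀ g, g = 1 ∨ g ∈ P ∨ g⁻¹ ∈ P) :
    ∃ r : G → G → Prop, IsLeftOrder r ∧ positiveCone r = (P : Set G) := by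
  refine ⟨fun g h => g⁻¹ * h ∈ P, ⟨?_, ?_⟩, ?_⟩
  · refine { trichotomous := ?_, irrefl := ?_, trans := ?_ }
    · intro g h hgh hhg
      rcases hP (g⁻¹ * h) with h | h | h
      · exact inv_mul_eq_one.mp h
      · exact absurd h hgh
      · exact absurd (by simpa using h) hhg
    · intro g hg
      exact h1 (by simpa using hg)
    · intro f g h hfg hgh
      have := P.mul_mem hfg hgh
      simpa [mul_assoc] using this
  · intro f g h
    simp [mul_assoc]
  · ext g
    simp [positiveCone]

theorem mem_submonoidClosure_iff {M : Type*} [Monoid M] (S : Set M) (g : M) :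
    g ∈ Submonoid.closure S ↔ g = 1 ∨ g ∈ Subsemigroup.closure S := by
  constructor
  · intro h
    induction h using Submonoid.closure_induction with
    | mem x hx => exact Or.inr (Subsemigroup.subset_closure hx)
    | one => exact Or.inl rfl
    | mul x y _ _ hx hy =>
      rcases hx with rfl | hx
      · simpa using hy
      · rcases hy with rfl | hy
        · simpa using Or.inr hx
        · exact Or.inr (mul_mem hx hy)
  · rintro (rfl | h)
    · exact one_mem _
    · have : Subsemigroup.closure S ≤ (Submonoid.closure S).toSubsemigroup :=
        Subsemigroup.closure_le.mpr Submonoid.subset_closure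
      exact this h

/-! ### The group `Γ₂` -/

theorem relation : b * a ^ 2 * b = a := by
  have := PresentedGroup.one_of_mem (rels := gammaRels) rfl
  exact mul_inv_eq_one.mp this

theorem b_mul_sq_sq : (b * a ^ 2) * (b * a ^ 2) = a ^ 3 := by
  rw [← mul_assoc, relation, ← pow_succ']

/-- Being the square of ba², a³ commutes with ba² as well as with a. -/
theorem commute_cube_b : Commute (a ^ 3) b := by
  have hs : Commute (a ^ 3) (b * a ^ 2) := by
    rw [← b_mul_sq_sq]
    exact (Commute.refl _).mul_left (Commute.refl _)
  have ha : Commute (a ^ 3) (a ^ 2)⁻¹ := (Commute.pow_pow_self a 3 2).inv_right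
  simpa using hs.mul_right ha

theorem closure_gen : Subgroup.closure ({a, b} : Set Gamma) = ⊤ := by
  have h := PresentedGroup.closure_range_of gammaRels
  rw [← h]
  congr 1
  ext g
  simp only [Set.mem_insert_iff, Set.mem_singleton_iff, Set.mem_range, Fin.exists_fin_two]
  exact or_congr eq_comm eq_comm

theorem commute_cube (g : Gamma) : Commute (a ^ 3) g := by
  have : Subgroup.closure ({a, b} : Set Gamma) ≤ Subgroup.centralizer {a ^ 3} := by
    rw [Subgroup.closure_le]
    rintro g (rfl | rfl) <;> rw [SetLike.mem_coe, Subgroup.mem_centralizer_singleton_iff]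
    · exact (Commute.pow_self a 3).symm
    · exact commute_cube_b.symm
  rw [closure_gen] at this
  exact (Subgroup.mem_centralizer_singleton_iff.mp (this trivial)).symm

theorem b_inv_mul_a : b⁻¹ * a = a ^ 2 * b := by
  rw [inv_mul_eq_iff_eq_mul, ← mul_assoc, relation]

/-- From a³ = (ba²)²: an inverse of b can be traded for a positive word at the cost of one a⁻¹. -/
theorem b_inv_eq : b⁻¹ = a⁻¹ * (b * a ^ 2) := by
  have h := b_mul_sq_sq
  have hc : a ^ 3 * b = b * a ^ 3 := commute_cube_b
  calc b⁻¹ = a ^ 2 * (b * a ^ 2)⁻¹ := by group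
    _ = a⁻¹ * (a ^ 3 * (b * a ^ 2)⁻¹) := by group
    _ = a⁻¹ * (b * a ^ 2) := by rw [← h, mul_inv_cancel_right]

/-! ### Normal forms and totality of the cone -/

/-- The submonoid of `Γ₂` generated by `a` and `b`. -/
def positive : Submonoid Gamma := Submonoid.closure {a, b}

theorem a_mem_positive : a ∈ positive := Submonoid.subset_closure (by simp)

theorem b_mem_positive : b ∈ positive := Submonoid.subset_closure (by simp)

/-- Products of the elements `b` and `b a`. -/
def reduced : Submonoid Gamma := Submonoid.closure {b, b * a}

theorem reduced_le : reduced ≤ positive := by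
  refine Submonoid.closure_le.mpr ?_
  rintro _ (rfl | rfl)
  · exact b_mem_positive
  · exact mul_mem b_mem_positive a_mem_positive

theorem b_mem_reduced : b ∈ reduced := Submonoid.subset_closure (by simp)

theorem ba_mem_reduced : b * a ∈ reduced := Submonoid.subset_closure (by simp)

theorem reduced_cases {w : Gamma} (hw : w ∈ reduced) :
    w = 1 ∨ ∃ v ∈ reduced, w = v * b ∨ w = v * (b * a) := by
  induction hw using Submonoid.closure_induction_right with
  | one => exact Or.inl rfl
  | mul_right v hv c hc _ =>
    refine Or.inr ⟨v, hv, ?_⟩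
    rcases hc with rfl | rfl
    · exact Or.inl rfl
    · exact Or.inr rfl

/-- `g` has the form `aᵏ w` or `aᵏ w a` with `w` a product of copies of `b` and `b a`. -/
def HasForm (g : Gamma) : Prop :=
  ∃ k : ℤ, ∃ w ∈ reduced, g = a ^ k * w ∨ g = a ^ k * w * a

theorem HasForm.zpow_mul {g : Gamma} (h : HasForm g) (m : ℤ) : HasForm (a ^ m * g) := by
  obtain ⟨k, w, hw, rfl | rfl⟩ := h
  · exact ⟨m + k, w, hw, Or.inl (by rw [zpow_add, mul_assoc])⟩
  · exact ⟨m + k, w, hw, Or.inr (by simp only [zpow_add, mul_assoc])⟩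

/-- A third consecutive a completes the central a³, which moves to the front. -/
theorem HasForm.mul_a {g : Gamma} (h : HasForm g) : HasForm (g * a) := by
  obtain ⟨k, w, hw, rfl | rfl⟩ := h
  · exact ⟨k, w, hw, Or.inr rfl⟩
  · rcases reduced_cases hw with rfl | ⟨v, hv, rfl | rfl⟩
    · exact ⟨k + 2, 1, one_mem _, Or.inl (by group)⟩
    · exact ⟨k, v * (b * a), mul_mem hv ba_mem_reduced, Or.inr (by group)⟩
    · refine ⟨k + 3, v * b, mul_mem hv b_mem_reduced, Or.inl ?_⟩
      have h3 := (commute_cube (v * b)).eq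
      calc a ^ k * (v * (b * a)) * a * a = a ^ k * ((v * b) * a ^ 3) := by simp only [pow_three, mul_assoc]
        _ = a ^ k * (a ^ 3 * (v * b)) := by rw [h3]
        _ = _ := by group

/-- The only new pattern outside the normal form is ba²b, which collapses to a. -/
theorem HasForm.mul_b {g : Gamma} (h : HasForm g) : HasForm (g * b) := by
  obtain ⟨k, w, hw, rfl | rfl⟩ := h
  · exact ⟨k, w * b, mul_mem hw b_mem_reduced, Or.inl (by group)⟩
  · rcases reduced_cases hw with rfl | ⟨v, hv, rfl | rfl⟩
    · exact ⟨k + 1, b, b_mem_reduced, Or.inl (by group)⟩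
    · exact ⟨k, v * (b * a) * b, mul_mem (mul_mem hv ba_mem_reduced) b_mem_reduced,
        Or.inl (by group)⟩
    · refine ⟨k, v, hv, Or.inr ?_⟩
      calc a ^ k * (v * (b * a)) * a * b = a ^ k * v * (b * a ^ 2 * b) := by simp only [pow_two, mul_assoc]
        _ = a ^ k * v * a := by rw [relation]

theorem HasForm.mul_a_inv {g : Gamma} (h : HasForm g) : HasForm (g * a⁻¹) := by
  have h3 := (commute_cube g).eq
  have : g * a⁻¹ = a ^ (-3 : ℤ) * (g * a * a) :=
    calc g * a⁻¹ = a ^ (-3 : ℤ) * (a ^ 3 * g) * a⁻¹ := by group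
      _ = a ^ (-3 : ℤ) * (g * a ^ 3) * a⁻¹ := by rw [h3]
      _ = _ := by rw [pow_three']; group
  rw [this]
  exact h.mul_a.mul_a.zpow_mul _

theorem hasForm (g : Gamma) : HasForm g := by
  have hg : g ∈ Subgroup.closure ({a, b} : Set Gamma) := closure_gen ▸ trivial
  induction hg using Subgroup.closure_induction_right with
  | one => exact ⟨0, 1, one_mem _, Or.inl (by simp)⟩
  | mul_right g _ c hc ih =>
    rcases hc with rfl | rfl
    · exact ih.mul_a
    · exact ih.mul_b
  | mul_inv_cancel g _ c hc ih =>
    rcases hc with rfl | rfl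
    · exact ih.mul_a_inv
    · rw [b_inv_eq, ← mul_assoc, pow_two, ← mul_assoc, ← mul_assoc]
      exact ih.mul_a_inv.mul_b.mul_a.mul_a

/-- Since b⁻¹ = a⁻¹ba² and (ba)⁻¹ = a⁻²ba², concatenating inverses leaves only a or 1 between
successive b's; negative powers survive only at the left end. -/
theorem inv_of_mem_reduced {w : Gamma} (hw : w ∈ reduced) :
    w = 1 ∨ ∃ v ∈ reduced, w⁻¹ = a⁻¹ * v * (b * a ^ 2) ∨ w⁻¹ = (a ^ 2)⁻¹ * v * (b * a ^ 2) := by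
  have hba : (b * a)⁻¹ = (a ^ 2)⁻¹ * (b * a ^ 2) := by
    rw [mul_inv_rev, b_inv_eq]; group
  induction hw using Submonoid.closure_induction_left with
  | one => exact Or.inl rfl
  | mul_left c hc w _ ih =>
    right
    rcases hc with rfl | rfl
    · rcases ih with rfl | ⟨v, hv, h | h⟩
      · exact ⟨1, one_mem _, Or.inl (by simpa using b_inv_eq)⟩
      · refine ⟨v * (b * a), mul_mem hv ba_mem_reduced, Or.inl ?_⟩
        rw [mul_inv_rev, h, b_inv_eq]; group
      · refine ⟨v * (b * a), mul_mem hv ba_mem_reduced, Or.inr ?_⟩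
        rw [mul_inv_rev, h, b_inv_eq]; group
    · rcases ih with rfl | ⟨v, hv, h | h⟩
      · exact ⟨1, one_mem _, Or.inr (by simpa using hba)⟩
      · refine ⟨v * b, mul_mem hv b_mem_reduced, Or.inl ?_⟩
        rw [mul_inv_rev, h, hba]; group
      · refine ⟨v * b, mul_mem hv b_mem_reduced, Or.inr ?_⟩
        rw [mul_inv_rev, h, hba]; group

theorem zpow_mem_positive {k : ℤ} (hk : 0 ≤ k) : a ^ k ∈ positive := by
  lift k to ℕ using hk
  rw [zpow_natCast]
  exact pow_mem a_mem_positive k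

theorem b_mul_zpow_mem_positive {k : ℤ} (hk : 0 ≤ k) : b * a ^ k ∈ positive :=
  mul_mem b_mem_positive (zpow_mem_positive hk)

theorem mem_positive_or_inv_mem (g : Gamma) : g ∈ positive ∨ g⁻¹ ∈ positive := by
  obtain ⟨k, w, hw, h⟩ := hasForm g
  rcases le_or_gt 0 k with hk | hk
  · left
    rcases h with rfl | rfl
    · exact mul_mem (zpow_mem_positive hk) (reduced_le hw)
    · exact mul_mem (mul_mem (zpow_mem_positive hk) (reduced_le hw)) a_mem_positive
  rcases inv_of_mem_reduced hw with rfl | ⟨v, hv, hi⟩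
  · obtain ⟨m, rfl⟩ : ∃ m : ℤ, g = a ^ m := by
      rcases h with rfl | rfl
      · exact ⟨k, by simp⟩
      · exact ⟨k + 1, by group⟩
    rcases le_total 0 m with hm | hm
    · exact Or.inl (zpow_mem_positive hm)
    · right
      rw [← zpow_neg]
      exact zpow_mem_positive (by omega)
  right
  -- The right end carries a^(2 - k) with k < 0, so a central a³ can move left, where at most a⁻³
  -- has to be absorbed (a⁻² from w⁻¹, one more from a trailing a).
  have key : ∀ j : ℤ, 0 ≤ j + 3 → a ^ j * v * (b * a ^ 2) * a ^ (-k) ∈ positive := by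
    intro j hj
    have h3 := (commute_cube (a ^ j * v * (b * a ^ 2))).eq
    have : a ^ j * v * (b * a ^ 2) * a ^ (-k) = a ^ (j + 3) * v * (b * a ^ (-k - 1)) :=
      calc a ^ j * v * (b * a ^ 2) * a ^ (-k)
          = (a ^ j * v * (b * a ^ 2)) * a ^ 3 * a ^ (-k - 3) := by group
        _ = a ^ 3 * (a ^ j * v * (b * a ^ 2)) * a ^ (-k - 3) := by rw [h3]
        _ = _ := by group
    rw [this]
    exact mul_mem (mul_mem (zpow_mem_positive hj) (reduced_le hv))
      (b_mul_zpow_mem_positive (by omega))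
  rcases h with rfl | rfl <;> rcases hi with hi | hi <;>
    simp only [mul_inv_rev, hi, ← zpow_neg]
  · simpa using key (-1) (by norm_num)
  · simpa using key (-2) (by norm_num)
  · have := key (-2) (by norm_num)
    convert this using 1
    group
  · have := key (-3) (by norm_num)
    convert this using 1
    group

/-! ### An action of `Γ₂` showing that no nonempty word in `a` and `b` is trivial -/

/-- The lift to `ℤ` copies of the projective line of the order three map `q ↦ 1 / (1 - q)`. -/
def actA : Equiv.Perm (ℤ × Option ℚ) where
  toFun
    | (n, none) => (n, some 0)
    | (n, some q) => if q = 1 then (n + 1, none) else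
        (if q < 1 then n else n + 1, some (1 - q)⁻¹)
  invFun
    | (n, none) => (n - 1, some 1)
    | (n, some q) => if q = 0 then (n, none) else
        (if 0 < q then n else n - 1, some (1 - q⁻¹))
  left_inv := by
    rintro ⟨n, _ | q⟩
    · simp
    · by_cases h1 : q = 1
      · simp [h1]
      · have : 1 - q ≠ 0 := sub_ne_zero.mpr (Ne.symm h1)
        by_cases h : q < 1 <;> simp [h1, h, this]
  right_inv := by
    rintro ⟨n, _ | q⟩
    · simp
    · by_cases h1 : q = 0
      · simp [h1]
      · have h2 : 1 - q⁻¹ < 1 ↔ 0 < q := by simp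
        by_cases h : 0 < q <;> simp [h1, h]

/-- The lift of `q ↦ q - 1`. -/
def actB : Equiv.Perm (ℤ × Option ℚ) :=
  Equiv.prodCongr (Equiv.refl ℤ) (Equiv.optionCongr (Equiv.subRight 1))

/-- On the projective line both sides are q ↦ 1/(1 - q); the cases check that the copy index agrees,
with q = 1 and q = 2 the points whose paths meet ∞. -/
theorem act_rel (p : ℤ × Option ℚ) : actB (actA (actA (actB p))) = actA p := by
  obtain ⟨n, _ | q⟩ := p
  · simp [actA, actB]
  · by_cases h1 : q = 1
    · subst h1; simp [actA, actB]
    by_cases h2 : q = 2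
    · subst h2; norm_num [actA, actB]
    have e1 : 1 - q ≠ 0 := sub_ne_zero.mpr (Ne.symm h1)
    have e2 : 2 - q ≠ 0 := sub_ne_zero.mpr (Ne.symm h2)
    have e3 : 1 - (q - 1) = 2 - q := by ring
    have e4 : q - 1 ≠ 1 := fun h => h2 (by linarith)
    have e5 : (2 - q)⁻¹ ≠ 1 := fun h => h1 (by rw [inv_eq_one] at h; linarith)
    have e6 : (1 - (2 - q)⁻¹)⁻¹ - 1 = (1 - q)⁻¹ := by
      have : 1 - (2 - q)⁻¹ = (1 - q) / (2 - q) := by field_simp; ring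
      rw [this, inv_div]; field_simp; ring
    simp only [actA, actB, Equiv.prodCongr_apply, Equiv.coe_refl, Prod.map, id,
      Equiv.optionCongr_apply, Option.map_some, Equiv.subRight_apply, Equiv.coe_fn_mk, e4,
      if_false, e3, e5, h1, e6, Prod.mk.injEq, and_true]
    rcases lt_trichotomy q 1 with h | h | h
    · have : (2 - q)⁻¹ < 1 := inv_lt_one_of_one_lt₀ (by linarith)
      simp [h, this, show q - 1 < 1 by linarith]
    · exact absurd h h1
    · by_cases h' : q < 2
      · have : 1 < (2 - q)⁻¹ := (one_lt_inv₀ (by linarith)).mpr (by linarith)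
        simp [h.le, this.le, show q - 1 < 1 by linarith, not_lt.mpr]
      · have h'' : 2 < q := lt_of_le_of_ne (not_lt.mp h') (Ne.symm h2)
        have : (2 - q)⁻¹ < 1 := (inv_lt_zero.mpr (by linarith)).trans one_pos
        simp [h.le, this, show ¬ q - 1 < 1 by linarith, not_lt.mpr]

theorem act_rels : ∀ w ∈ gammaRels, FreeGroup.lift ![actA, actB] w = 1 := by
  rintro w rfl
  simp only [map_mul, map_pow, map_inv, FreeGroup.lift_apply_of]
  rw [mul_inv_eq_one]
  ext1 p
  exact act_rel p

/-- The action of `Γ₂` on `ℤ` copies of the projective line over `ℚ`. -/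
def act : Gamma →* Equiv.Perm (ℤ × Option ℚ) := PresentedGroup.toGroup act_rels

theorem act_a : act a = actA := PresentedGroup.toGroup.of act_rels

theorem act_b : act b = actB := PresentedGroup.toGroup.of act_rels

/-- The points above the base point `(0, ∞)`. -/
def above : Set (ℤ × Option ℚ) := {p | 0 < p.1 ∨ p.1 = 0 ∧ p.2 ≠ none}

theorem actA_above {p : ℤ × Option ℚ} (hp : p ∈ above) : actA p ∈ above := by
  obtain ⟨n, _ | q⟩ := p
  · simp_all [above, actA]
  · have hn : 0 < n ∨ n = 0 := by simpa [above] using hp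
    simp only [above, actA, Equiv.coe_fn_mk, Set.mem_ofPred_eq]
    split_ifs <;> simp <;> omega

theorem actB_above {p : ℤ × Option ℚ} (hp : p ∈ above) : actB p ∈ above := by
  obtain ⟨n, _ | q⟩ := p <;> simpa [above, actB] using hp

theorem gammaExp_rels : ∀ w ∈ gammaRels,
    FreeGroup.lift ![Multiplicative.ofAdd (-2 : ℤ), Multiplicative.ofAdd 1] w = 1 := by
  rintro w rfl
  simp only [map_mul, map_pow, map_inv, FreeGroup.lift_apply_of]
  decide

/-- The abelianization `Γ₂ → ℤ` with `a ↦ -2`, `b ↦ 1`. -/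
def gammaExp : Gamma →* Multiplicative ℤ := PresentedGroup.toGroup gammaExp_rels

theorem gammaExp_a : gammaExp a = Multiplicative.ofAdd (-2) :=
  PresentedGroup.toGroup.of gammaExp_rels

theorem gammaExp_b : gammaExp b = Multiplicative.ofAdd 1 :=
  PresentedGroup.toGroup.of gammaExp_rels

/-- Here b fixes the base point, a pushes it up, and neither brings a point of `above` back down. -/
theorem above_or_pow {g : Gamma} (hg : g ∈ positive) :
    act g (0, none) ∈ above ∨ ∃ k : ℕ, g = b ^ k := by
  induction hg using Submonoid.closure_induction_left with
  | one => exact Or.inr ⟨0, by simp⟩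
  | mul_left c hc g _ ih =>
    have hpow (k : ℕ) : act (b ^ k) (0, none) = (0, none) := by
      rw [map_pow, act_b]
      induction k with
      | zero => rfl
      | succ k ih => rw [pow_succ', Equiv.Perm.mul_apply, ih]; simp [actB]
    rcases hc with rfl | rfl
    · left
      rw [map_mul, act_a, Equiv.Perm.mul_apply]
      rcases ih with h | ⟨k, rfl⟩
      · exact actA_above h
      · rw [hpow]; simp [above, actA]
    · rcases ih with h | ⟨k, rfl⟩
      · left
        rw [map_mul, act_b, Equiv.Perm.mul_apply]
        exact actB_above h
      · exact Or.inr ⟨k + 1, (pow_succ' b k).symm⟩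

/-- If either element raised the base point, the other could not return it. So both are nonnegative
powers of b, and exponents must cancel. -/
theorem eq_one_of_inv_mem {g : Gamma} (hg : g ∈ positive) (hg' : g⁻¹ ∈ positive) : g = 1 := by
  have key : ∀ {g h : Gamma}, g ∈ positive → h ∈ positive → act g (0, none) ∈ above →
      act (h * g) (0, none) ∈ above := by
    intro g h _ hh hg
    induction hh using Submonoid.closure_induction_left with
    | one => simpa using hg
    | mul_left c hc h _ ih =>
      rw [mul_assoc, map_mul, Equiv.Perm.mul_apply]
      rcases hc with rfl | rfl
      · rw [act_a]; exact actA_above ih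
      · rw [act_b]; exact actB_above ih
  have h0 : ((0, none) : ℤ × Option ℚ) ∉ above := by simp [above]
  rcases above_or_pow hg with h | ⟨k, rfl⟩
  · exact absurd (by simpa using key hg hg' h) h0
  rcases above_or_pow hg' with h | ⟨l, hl⟩
  · exact absurd (by simpa using key hg' hg h) h0
  have := congrArg (fun g => Multiplicative.toAdd (gammaExp g)) hl
  simp [gammaExp_b] at this
  have : k = 0 := by omega
  simp [this]

theorem mul_ne_one_of_mem {g h : Gamma} (hg : g ∈ positive) (hh : h ∈ positive) (hg1 : g ≠ 1) :
    g * h ≠ 1 := by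
  intro e
  exact hg1 (eq_one_of_inv_mem hg (by rwa [inv_eq_of_mul_eq_one_right e]))

theorem a_ne_one : a ≠ 1 := by
  intro h
  have := congrArg (fun g => Multiplicative.toAdd (gammaExp g)) h
  simp [gammaExp_a] at this

theorem b_ne_one : b ≠ 1 := by
  intro h
  have := congrArg (fun g => Multiplicative.toAdd (gammaExp g)) h
  simp [gammaExp_b] at this

theorem one_notMem_cone : (1 : Gamma) ∉ Subsemigroup.closure ({a, b} : Set Gamma) := by
  have : ∀ g ∈ Subsemigroup.closure ({a, b} : Set Gamma), g ∈ positive ∧ g ≠ 1 := by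
    intro g hg
    induction hg using Subsemigroup.closure_induction with
    | mem g hg =>
      rcases hg with rfl | rfl
      · exact ⟨a_mem_positive, a_ne_one⟩
      · exact ⟨b_mem_positive, b_ne_one⟩
    | mul g h _ _ hg hh => exact ⟨mul_mem hg.1 hh.1, mul_ne_one_of_mem hg.1 hh.1 hg.2⟩
  exact fun h => (this 1 h).2 rfl

/-! ### The isomorphism with the braid group -/

theorem braid_relation : σ₁ * σ₂ * σ₁ = σ₂ * σ₁ * σ₂ := by
  have := PresentedGroup.one_of_mem (rels := braidRels) rfl
  exact mul_inv_eq_one.mp this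

theorem toB3_rels : ∀ w ∈ gammaRels, FreeGroup.lift ![σ₁ * σ₂, σ₂⁻¹] w = 1 := by
  rintro w rfl
  simp only [map_mul, map_pow, map_inv, FreeGroup.lift_apply_of]
  rw [mul_inv_eq_one]
  change σ₂⁻¹ * (σ₁ * σ₂) ^ 2 * σ₂⁻¹ = σ₁ * σ₂
  calc σ₂⁻¹ * (σ₁ * σ₂) ^ 2 * σ₂⁻¹ = σ₂⁻¹ * (σ₁ * σ₂ * σ₁) := by rw [pow_two]; group
    _ = σ₁ * σ₂ := by rw [braid_relation]; group

/-- The inverse is forced: σ₁ = (σ₁σ₂)σ₂⁻¹ corresponds to ab. -/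
theorem ofB3_rels : ∀ w ∈ braidRels, FreeGroup.lift ![a * b, b⁻¹] w = 1 := by
  rintro w rfl
  simp only [map_mul, map_inv, FreeGroup.lift_apply_of]
  rw [mul_inv_eq_one]
  change a * b * b⁻¹ * (a * b) = b⁻¹ * (a * b) * b⁻¹
  calc a * b * b⁻¹ * (a * b) = a ^ 2 * b := by rw [pow_two]; group
    _ = b⁻¹ * a := b_inv_mul_a.symm
    _ = _ := by group

/-- The isomorphism `Γ₂ ≃ B₃` with `a ↦ σ₁ σ₂`, `b ↦ σ₂⁻¹`. -/
def gammaEquivB3 : Gamma ≃* B3 :=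
  MonoidHom.toMulEquiv (PresentedGroup.toGroup toB3_rels) (PresentedGroup.toGroup ofB3_rels)
    (by
      ext i
      fin_cases i
      · simp [PresentedGroup.toGroup.of, σ₁, σ₂]; rfl
      · simp [PresentedGroup.toGroup.of, σ₂]; rfl)
    (by
      ext i
      fin_cases i
      · simp [PresentedGroup.toGroup.of, a, b]; rfl
      · simp [PresentedGroup.toGroup.of, b]; rfl)

theorem gammaEquivB3_a : gammaEquivB3 a = σ₁ * σ₂ :=
  PresentedGroup.toGroup.of (x := 0) toB3_rels

theorem gammaEquivB3_b : gammaEquivB3 b = σ₂⁻¹ :=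
  PresentedGroup.toGroup.of (x := 1) toB3_rels

/-! ### The cone of `H` -/

theorem index_H : H.index = 6 := by
  have : Function.Surjective phi := by
    intro k
    refine ⟨b ^ (Multiplicative.toAdd k).val, ?_⟩
    rw [map_pow, phi_b, ← ofAdd_nsmul]
    simp
  rw [H, Subgroup.index_ker, MonoidHom.range_eq_top.mpr this]
  simp

/-- Each b⁻¹ is absorbed using b⁻¹a = a²b, which peels off a positive factor ab and leaves a shorter
power of b⁻¹. -/
theorem conj_mem_cone (k j : ℕ) :
    (b ^ k)⁻¹ * a * b ^ j ∈ Subsemigroup.closure ({a, b} : Set Gamma) := by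
  have ha : a ∈ Subsemigroup.closure ({a, b} : Set Gamma) :=
    Subsemigroup.subset_closure (by simp)
  have hb : b ∈ Subsemigroup.closure ({a, b} : Set Gamma) :=
    Subsemigroup.subset_closure (by simp)
  induction j with
  | succ j ih => rw [pow_succ, ← mul_assoc]; exact mul_mem ih hb
  | zero =>
    induction k with
    | zero => simpa using ha
    | succ k ih =>
      have : (b ^ (k + 1))⁻¹ * a * b ^ 0 = ((b ^ k)⁻¹ * a * b ^ 0) * (a * b) := by
        rw [pow_succ', mul_inv_rev, mul_assoc _ b⁻¹, b_inv_mul_a, pow_two]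
        group
      rw [this]
      exact mul_mem ih (mul_mem ha hb)

theorem coneGamma_mem_cone (i : Fin 7) :
    coneGamma i ∈ Subsemigroup.closure ({a, b} : Set Gamma) := by
  have hb : b ∈ Subsemigroup.closure ({a, b} : Set Gamma) :=
    Subsemigroup.subset_closure (by simp)
  fin_cases i
  · change a * b ^ 2 ∈ _
    simpa using conj_mem_cone 0 2
  · change b⁻¹ * a * b ^ 3 ∈ _
    simpa using conj_mem_cone 1 3
  · exact conj_mem_cone 2 4
  · exact conj_mem_cone 3 5
  · change (b ^ 4)⁻¹ * a ∈ _
    simpa using conj_mem_cone 4 0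
  · change (b ^ 5)⁻¹ * a * b ∈ _
    simpa using conj_mem_cone 5 1
  · change b ^ 6 ∈ _
    simp only [pow_succ, pow_zero, one_mul]
    exact mul_mem (mul_mem (mul_mem (mul_mem (mul_mem hb hb) hb) hb) hb) hb

/-- A Reidemeister–Schreier rewriting: a letter a sends i to i + 2 mod 6 and emits b⁻ⁱabʲ with j the
new index; a letter b lowers i by one, emitting b⁶ only when i wraps from 0 to 5. -/
theorem exists_coset_rep {g : Gamma} (hg : g ∈ positive) :
    ∃ h ∈ Submonoid.closure (Set.range coneH), ∃ i < 6, g = (h : Gamma) * (b ^ i)⁻¹ := by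
  have hY (i : Fin 7) : coneH i ∈ Submonoid.closure (Set.range coneH) :=
    Submonoid.subset_closure ⟨i, rfl⟩
  induction hg using Submonoid.closure_induction_right with
  | one => exact ⟨1, one_mem _, 0, by norm_num, by simp⟩
  | mul_right g _ c hc ih =>
    obtain ⟨h, hh, i, hi, rfl⟩ := ih
    rcases hc with rfl | rfl
    · interval_cases i
      · refine ⟨h * coneH 0, mul_mem hh (hY 0), 2, by norm_num, ?_⟩
        change _ = (h : Gamma) * (a * b ^ 2) * _
        group
      · refine ⟨h * coneH 1, mul_mem hh (hY 1), 3, by norm_num, ?_⟩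
        change _ = (h : Gamma) * (b⁻¹ * a * b ^ 3) * _
        group
      · refine ⟨h * coneH 2, mul_mem hh (hY 2), 4, by norm_num, ?_⟩
        change _ = (h : Gamma) * ((b ^ 2)⁻¹ * a * b ^ 4) * _
        group
      · refine ⟨h * coneH 3, mul_mem hh (hY 3), 5, by norm_num, ?_⟩
        change _ = (h : Gamma) * ((b ^ 3)⁻¹ * a * b ^ 5) * _
        group
      · refine ⟨h * coneH 4, mul_mem hh (hY 4), 0, by norm_num, ?_⟩
        change _ = (h : Gamma) * ((b ^ 4)⁻¹ * a) * _
        group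
      · refine ⟨h * coneH 5, mul_mem hh (hY 5), 1, by norm_num, ?_⟩
        change _ = (h : Gamma) * ((b ^ 5)⁻¹ * a * b) * _
        group
    · rcases i with _ | i
      · refine ⟨h * coneH 6, mul_mem hh (hY 6), 5, by norm_num, ?_⟩
        change _ = (h : Gamma) * b ^ 6 * _
        group
      · exact ⟨h, hh, i, by omega, by rw [pow_succ']; group⟩

theorem mem_closure_coneH_iff (h : H) : h ∈ Subsemigroup.closure (Set.range coneH) ↔
    (h : Gamma) ∈ Subsemigroup.closure ({a, b} : Set Gamma) := by
  constructor
  · intro hh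
    induction hh using Subsemigroup.closure_induction with
    | mem h hh =>
      obtain ⟨i, rfl⟩ := hh
      exact coneGamma_mem_cone i
    | mul g h _ _ hg hh => exact mul_mem hg hh
  · intro hh
    obtain ⟨k, hk, i, hi, e⟩ :=
      exists_coset_rep ((mem_submonoidClosure_iff _ _).mpr (Or.inr hh))
    have hi0 : i = 0 := by
      have h1 : phi h = 1 := h.2
      have h2 : phi k = 1 := k.2
      rw [e, map_mul, h2, one_mul, map_inv, inv_eq_one, map_pow, phi_b] at h1
      revert h1
      interval_cases i <;> decide
    subst hi0
    obtain rfl : h = k := Subtype.ext (by simpa using e)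
    rcases (mem_submonoidClosure_iff _ _).mp hk with rfl | hk
    · exact absurd hh one_notMem_cone
    · exact hk

theorem one_notMem_closure_coneH : (1 : H) ∉ Subsemigroup.closure (Set.range coneH) := by
  rw [mem_closure_coneH_iff]
  exact one_notMem_cone

theorem closure_coneH_total (h : H) : h = 1 ∨ h ∈ Subsemigroup.closure (Set.range coneH) ∨
    h⁻¹ ∈ Subsemigroup.closure (Set.range coneH) := by
  simp only [mem_closure_coneH_iff]
  rcases mem_positive_or_inv_mem (h : Gamma) with hh | hh <;>
    rcases (mem_submonoidClosure_iff _ _).mp hh with hh | hh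
  · exact Or.inl (Subtype.ext hh)
  · exact Or.inr (Or.inl hh)
  · exact Or.inl (Subtype.ext (inv_eq_one.mp hh))
  · exact Or.inr (Or.inr hh)

/-! ### The isomorphism of `H` with `F₂ × ℤ` -/

/-- The element `a b²`. -/
def xΓ : Gamma := a * b ^ 2

/-- The conjugate `a (a b²) a⁻¹`. -/
def uΓ : Gamma := a ^ 2 * b ^ 2 * a⁻¹

/-- With `conj_uΓ`, this shows how b normalises ⟨x, u⟩; the inverse action is `freeAut`. -/
theorem conj_xΓ : b⁻¹ * xΓ * b = uΓ * xΓ :=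
  calc b⁻¹ * (a * b ^ 2) * b = b⁻¹ * a * b ^ 3 := by group
    _ = a ^ 2 * b * b ^ 3 := by rw [b_inv_mul_a]
    _ = a ^ 2 * b ^ 2 * a⁻¹ * (a * b ^ 2) := by group

theorem conj_uΓ : b⁻¹ * uΓ * b = xΓ⁻¹ := by
  have h1 : a ^ 2 = b⁻¹ * a * b⁻¹ := by rw [b_inv_mul_a]; group
  have h2 : a⁻¹ * b = b⁻¹ * (a ^ 2)⁻¹ := by rw [h1]; group
  calc b⁻¹ * (a ^ 2 * b ^ 2 * a⁻¹) * b = b⁻¹ * a * a * b ^ 2 * (a⁻¹ * b) := by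
        rw [pow_two a]; group
    _ = a ^ 2 * b * a * b * (a ^ 2)⁻¹ := by rw [b_inv_mul_a, h2]; group
    _ = (b⁻¹ * a * b⁻¹) * b * a * b * (b⁻¹ * a * b⁻¹)⁻¹ := by rw [← h1]
    _ = b⁻¹ * (a ^ 2 * b) * (b * a⁻¹ * b) := by rw [pow_two]; group
    _ = b⁻¹ * (b⁻¹ * a) * (b * a⁻¹ * b) := by rw [b_inv_mul_a]
    _ = (b ^ 2)⁻¹ * (a * b * a⁻¹) * b := by rw [pow_two]; group
    _ = (b ^ 2)⁻¹ * (a⁻¹ * (a ^ 2 * b) * a⁻¹) * b := by rw [pow_two]; group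
    _ = (b ^ 2)⁻¹ * (a⁻¹ * (b⁻¹ * a) * a⁻¹) * b := by rw [b_inv_mul_a]
    _ = (a * b ^ 2)⁻¹ := by group

/-- The homomorphism `F₂ × ℤ → H` with `x ↦ a b²`, `y ↦ a² b² a²`, `z ↦ a³`. -/
def toH : F2Z →* H :=
  MonoidHom.noncommCoprod (FreeGroup.lift ![genH 0, genH 1]) (zpowersHom H (genH 2)) (by
    intro w k
    rw [zpowersHom_apply]
    exact ((show Commute (genH 2) _ from Subtype.ext (commute_cube _).eq).zpow_left _).symm)

theorem toH_x : toH x = genH 0 := by simp [toH, x]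

theorem toH_y : toH y = genH 1 := by simp [toH, y]

theorem toH_z : toH z = genH 2 := by simp [toH, z]

theorem toH_x_coe : (toH x : Gamma) = xΓ := by rw [toH_x]; rfl

theorem toH_z_coe : (toH z : Gamma) = a ^ 3 := by rw [toH_z]; rfl

theorem toH_u_coe : (toH (y * z⁻¹) : Gamma) = uΓ := by
  rw [map_mul, map_inv, toH_y, toH_z]
  change a ^ 2 * b ^ 2 * a ^ 2 * (a ^ 3)⁻¹ = a ^ 2 * b ^ 2 * a⁻¹
  group

theorem coneF2Z_eq : coneF2Z =
    ![x, (y * z⁻¹) * x, x⁻¹ * (y * z⁻¹) * x, x⁻¹ * (y * z⁻¹)⁻¹ * x⁻¹ * (y * z⁻¹) * x,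
      x⁻¹ * (y * z⁻¹)⁻¹ * z, x⁻¹ * (y * z⁻¹)⁻¹ * x * z,
      (y * z⁻¹)⁻¹ * x⁻¹ * (y * z⁻¹) * x * z⁻¹] := by
  funext i
  fin_cases i <;> simp [coneF2Z, x, y, z, mul_assoc] <;> rfl

/-- With u = yz⁻¹, the elements b⁻ᵏabᵏ⁺² are the iterated conjugates of x by b⁻¹, computed from its
action on x and u. -/
theorem toH_coneF2Z (i : Fin 7) : toH (coneF2Z i) = coneH i := by
  apply Subtype.ext
  rw [coneF2Z_eq]
  let f : MulAut Gamma := MulAut.conj b⁻¹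
  have hf (g : Gamma) : f g = b⁻¹ * g * b := by simp [f]
  have hx : f xΓ = uΓ * xΓ := by rw [hf, conj_xΓ]
  have hu : f uΓ = xΓ⁻¹ := by rw [hf, conj_uΓ]
  have c0 : a * b ^ 2 = xΓ := rfl
  have c1 : b⁻¹ * a * b ^ 3 = uΓ * xΓ := by rw [← hx, hf, xΓ]; group
  have c2 : (b ^ 2)⁻¹ * a * b ^ 4 = xΓ⁻¹ * uΓ * xΓ :=
    calc (b ^ 2)⁻¹ * a * b ^ 4 = f (b⁻¹ * a * b ^ 3) := by rw [hf]; group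
      _ = _ := by rw [c1, map_mul, hu, hx, mul_assoc]
  have c3 : (b ^ 3)⁻¹ * a * b ^ 5 = xΓ⁻¹ * uΓ⁻¹ * xΓ⁻¹ * uΓ * xΓ :=
    calc (b ^ 3)⁻¹ * a * b ^ 5 = f ((b ^ 2)⁻¹ * a * b ^ 4) := by rw [hf]; group
      _ = _ := by simp only [c2, map_mul, map_inv, hu, hx]; group
  have c4' : (b ^ 4)⁻¹ * a * b ^ 6 = xΓ⁻¹ * uΓ⁻¹ * uΓ⁻¹ * xΓ⁻¹ * uΓ * xΓ :=
    calc (b ^ 4)⁻¹ * a * b ^ 6 = f ((b ^ 3)⁻¹ * a * b ^ 5) := by rw [hf]; group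
      _ = _ := by simp only [c3, map_mul, map_inv, hu, hx]; group
  -- Inserting powers of b makes a³ a product of the zeroth, second and fourth conjugates of x,
  -- times b⁻⁶; this expresses b⁶ in x, u and a³.
  have c6' : a ^ 3 = uΓ⁻¹ * xΓ⁻¹ * uΓ * xΓ * (b ^ 6)⁻¹ :=
    calc a ^ 3 = (a * b ^ 2) * ((b ^ 2)⁻¹ * a * b ^ 4) * ((b ^ 4)⁻¹ * a * b ^ 6) * (b ^ 6)⁻¹ := by
          rw [pow_three']; group
      _ = _ := by rw [c0, c2, c4']; group
  have c6 : b ^ 6 = uΓ⁻¹ * xΓ⁻¹ * uΓ * xΓ * (a ^ 3)⁻¹ := by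
    have h : b ^ 6 = (a ^ 3)⁻¹ * (uΓ⁻¹ * xΓ⁻¹ * uΓ * xΓ) := by rw [c6']; group
    rw [h, ((commute_cube _).inv_left).eq]
  have c4 : (b ^ 4)⁻¹ * a = xΓ⁻¹ * uΓ⁻¹ * a ^ 3 :=
    calc (b ^ 4)⁻¹ * a = ((b ^ 4)⁻¹ * a * b ^ 6) * (b ^ 6)⁻¹ := by group
      _ = xΓ⁻¹ * uΓ⁻¹ * (uΓ⁻¹ * xΓ⁻¹ * uΓ * xΓ * (b ^ 6)⁻¹) := by rw [c4']; group
      _ = _ := by rw [← c6']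
  have c5 : (b ^ 5)⁻¹ * a * b = xΓ⁻¹ * uΓ⁻¹ * xΓ * a ^ 3 :=
    calc (b ^ 5)⁻¹ * a * b = f ((b ^ 4)⁻¹ * a) := by rw [hf]; group
      _ = (uΓ * xΓ)⁻¹ * xΓ⁻¹⁻¹ * f (a ^ 3) := by
        rw [c4]; simp only [map_mul, map_inv, hu, hx]
      _ = _ := by rw [hf, ← ((commute_cube _).inv_right).eq]; group
  have tu := toH_u_coe
  generalize y * z⁻¹ = u at tu
  fin_cases i
  · exact toH_x_coe
  · change (toH (u * x) : Gamma) = b⁻¹ * a * b ^ 3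
    simp only [map_mul, Subgroup.coe_mul, tu, toH_x_coe, c1]
  · change (toH (x⁻¹ * u * x) : Gamma) = (b ^ 2)⁻¹ * a * b ^ 4
    simp only [map_mul, map_inv, Subgroup.coe_mul, Subgroup.coe_inv, tu, toH_x_coe, c2]
  · change (toH (x⁻¹ * u⁻¹ * x⁻¹ * u * x) : Gamma) = (b ^ 3)⁻¹ * a * b ^ 5
    simp only [map_mul, map_inv, Subgroup.coe_mul, Subgroup.coe_inv, tu, toH_x_coe, c3]
  · change (toH (x⁻¹ * u⁻¹ * z) : Gamma) = (b ^ 4)⁻¹ * a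
    simp only [map_mul, map_inv, Subgroup.coe_mul, Subgroup.coe_inv, tu, toH_x_coe, toH_z_coe, c4]
  · change (toH (x⁻¹ * u⁻¹ * x * z) : Gamma) = (b ^ 5)⁻¹ * a * b
    simp only [map_mul, map_inv, Subgroup.coe_mul, Subgroup.coe_inv, tu, toH_x_coe, toH_z_coe, c5]
  · change (toH (u⁻¹ * x⁻¹ * u * x * z⁻¹) : Gamma) = b ^ 6
    simp only [map_mul, map_inv, Subgroup.coe_mul, Subgroup.coe_inv, tu, toH_x_coe, toH_z_coe, c6]

/-- By totality the cone generates H as a group, and its seven generators already lie in the image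
of `toH`. -/
theorem closure_genH : Subgroup.closure (Set.range genH) = ⊤ := by
  have hg (i : Fin 3) : genH i ∈ Subgroup.closure (Set.range genH) :=
    Subgroup.subset_closure ⟨i, rfl⟩
  have hrange (t : F2Z) : toH t ∈ Subgroup.closure (Set.range genH) := by
    obtain ⟨w, k⟩ := t
    simp only [toH, MonoidHom.noncommCoprod_apply, zpowersHom_apply]
    refine mul_mem ?_ (zpow_mem (hg 2) _)
    refine FreeGroup.range_lift_le ?_ ⟨w, rfl⟩
    rintro _ ⟨i, rfl⟩
    fin_cases i
    · exact hg 0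
    · exact hg 1
  have hcone : Subsemigroup.closure (Set.range coneH) ≤
      (Subgroup.closure (Set.range genH)).toSubmonoid.toSubsemigroup := by
    rw [Subsemigroup.closure_le]
    rintro _ ⟨i, rfl⟩
    rw [← toH_coneF2Z]
    exact hrange _
  rw [eq_top_iff]
  rintro h -
  rcases closure_coneH_total h with rfl | hh | hh
  · exact one_mem _
  · exact hcone hh
  · exact inv_mem_iff.mp (hcone hh)

theorem closure_genGamma : Subgroup.closure (Set.range genGamma) = H := by
  have h := congrArg (Subgroup.map H.subtype) closure_genH
  rwa [MonoidHom.map_closure, ← Set.range_comp, ← MonoidHom.range_eq_map,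
    Subgroup.range_subtype] at h

theorem toH_surjective : Function.Surjective toH := by
  rw [← MonoidHom.range_eq_top, eq_top_iff, ← closure_genH, Subgroup.closure_le]
  rintro _ ⟨i, rfl⟩
  fin_cases i
  · exact ⟨x, toH_x⟩
  · exact ⟨y, toH_y⟩
  · exact ⟨z, toH_z⟩

/-! ### Injectivity through a semidirect product -/

/-- The automorphism `x ↦ u⁻¹`, `u ↦ x u` of the free group on `x, u`. -/
def freeAut : MulAut (FreeGroup (Fin 2)) :=
  MonoidHom.toMulEquiv
    (FreeGroup.lift ![(FreeGroup.of 1)⁻¹, FreeGroup.of 0 * FreeGroup.of 1])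
    (FreeGroup.lift ![FreeGroup.of 1 * FreeGroup.of 0, (FreeGroup.of 0)⁻¹])
    (by
      ext i
      fin_cases i <;> simp)
    (by
      ext i
      fin_cases i <;> simp)

/-- The semidirect product of the free group on `x, u` with the infinite cyclic group acting
through `freeAut`. -/
abbrev Semi : Type := FreeGroup (Fin 2) ⋊[zpowersHom _ freeAut] Multiplicative ℤ

/-- The generator of the cyclic factor of `Semi`. -/
def tSemi : Semi := SemidirectProduct.inr (Multiplicative.ofAdd 1)

/-- The generator `x` of the free factor of `Semi`. -/
def xSemi : Semi := SemidirectProduct.inl (FreeGroup.of 0)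

/-- The generator `u` of the free factor of `Semi`. -/
def uSemi : Semi := SemidirectProduct.inl (FreeGroup.of 1)

theorem tSemi_conj (n : FreeGroup (Fin 2)) :
    tSemi * SemidirectProduct.inl n * tSemi⁻¹ = SemidirectProduct.inl (freeAut n) := by
  rw [tSemi, ← map_inv, ← SemidirectProduct.inl_aut]
  simp

theorem tSemi_conj_x : tSemi * xSemi * tSemi⁻¹ = uSemi⁻¹ := by
  rw [xSemi, tSemi_conj, uSemi, ← map_inv]
  exact congrArg _ (by simp [freeAut])

theorem tSemi_conj_u : tSemi * uSemi * tSemi⁻¹ = xSemi * uSemi := by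
  rw [uSemi, tSemi_conj, xSemi, ← map_mul]
  exact congrArg _ (by simp [freeAut])

theorem tSemi_inv_conj_u : tSemi⁻¹ * uSemi * tSemi = xSemi⁻¹ := by
  rw [← inv_inv uSemi, ← tSemi_conj_x]
  group

theorem tSemi_inv_conj_x : tSemi⁻¹ * xSemi * tSemi = uSemi * xSemi :=
  calc tSemi⁻¹ * xSemi * tSemi
      = tSemi⁻¹ * (xSemi * uSemi) * tSemi * (tSemi⁻¹ * uSemi * tSemi)⁻¹ := by group
    _ = uSemi * xSemi := by rw [← tSemi_conj_u, tSemi_inv_conj_u]; group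

/-- Sending b to t and x = ab² to the free generator forces a ↦ xt⁻². -/
theorem toSemi_rels : ∀ w ∈ gammaRels,
    FreeGroup.lift ![xSemi * (tSemi ^ 2)⁻¹, tSemi] w = 1 := by
  rintro w rfl
  simp only [map_mul, map_pow, map_inv, FreeGroup.lift_apply_of]
  rw [mul_inv_eq_one]
  change tSemi * (xSemi * (tSemi ^ 2)⁻¹) ^ 2 * tSemi = xSemi * (tSemi ^ 2)⁻¹
  calc tSemi * (xSemi * (tSemi ^ 2)⁻¹) ^ 2 * tSemi
      = (tSemi * xSemi * tSemi⁻¹) * (tSemi⁻¹ * xSemi * tSemi) * (tSemi ^ 2)⁻¹ := by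
        rw [pow_two (xSemi * _)]; group
    _ = _ := by rw [tSemi_conj_x, tSemi_inv_conj_x]; group

/-- The homomorphism from `Γ₂` to `Semi` with `a ↦ x t⁻²`, `b ↦ t`. -/
def toSemi : Gamma →* Semi := PresentedGroup.toGroup toSemi_rels

theorem toSemi_a : toSemi a = xSemi * (tSemi ^ 2)⁻¹ := PresentedGroup.toGroup.of toSemi_rels

theorem toSemi_b : toSemi b = tSemi := PresentedGroup.toGroup.of toSemi_rels

theorem toSemi_xΓ : toSemi xΓ = xSemi := by
  rw [xΓ, map_mul, map_pow, toSemi_a, toSemi_b]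
  group

theorem toSemi_uΓ : toSemi uΓ = uSemi := by
  have : uΓ = (b⁻¹ * xΓ * b) * xΓ⁻¹ := by rw [conj_xΓ]; group
  rw [this]
  simp only [map_mul, map_inv, toSemi_xΓ, toSemi_b, tSemi_inv_conj_x]
  group

/-- The homomorphism from the free group on `x, u` to `Γ₂`. -/
def freeToGamma : FreeGroup (Fin 2) →* Gamma := FreeGroup.lift ![xΓ, uΓ]

theorem toSemi_freeToGamma (w : FreeGroup (Fin 2)) :
    toSemi (freeToGamma w) = SemidirectProduct.inl w := by
  have : toSemi.comp freeToGamma = SemidirectProduct.inl := by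
    ext1 i
    fin_cases i
    · simpa [freeToGamma, xSemi] using toSemi_xΓ
    · simpa [freeToGamma, uSemi] using toSemi_uΓ
  exact DFunLike.congr_fun this w

/-- The exponent sum of the second generator. -/
def expY : FreeGroup (Fin 2) →* Multiplicative ℤ := FreeGroup.lift ![1, Multiplicative.ofAdd 1]

/-- Because y = ua³ with a³ central, each y in w contributes one a³ beside u. -/
theorem toH_inl_coe (w : FreeGroup (Fin 2)) :
    (toH (w, 1) : Gamma) = freeToGamma w * a ^ (3 * (expY w).toAdd) := by
  have hc (k : ℤ) (g : Gamma) : a ^ (3 * k) * g = g * a ^ (3 * k) := by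
    rw [zpow_mul]
    exact (commute_cube g).zpow_left k
  let f : FreeGroup (Fin 2) →* Gamma :=
    { toFun := fun w => freeToGamma w * a ^ (3 * (expY w).toAdd)
      map_one' := by simp
      map_mul' := fun v w => by
        simp only [map_mul, toAdd_mul, mul_add, zpow_add]
        rw [mul_assoc (freeToGamma v), mul_assoc (freeToGamma v), ← mul_assoc (freeToGamma w),
          ← hc _ (freeToGamma w), mul_assoc] }
  have : (H.subtype.comp toH).comp (MonoidHom.inl _ _) = f := by
    ext1 i
    fin_cases i
    · change (toH x : Gamma) = freeToGamma _ * a ^ _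
      rw [toH_x_coe]
      simp [freeToGamma]
    · change (toH y : Gamma) = freeToGamma _ * a ^ _
      rw [toH_y]
      simp only [freeToGamma, FreeGroup.lift_apply_of]
      change a ^ 2 * b ^ 2 * a ^ 2 = a ^ 2 * b ^ 2 * a⁻¹ * a ^ (3 * (1 : ℤ))
      group
  exact DFunLike.congr_fun this w

theorem toH_coe (w : FreeGroup (Fin 2)) (k : Multiplicative ℤ) :
    (toH (w, k) : Gamma) = freeToGamma w * a ^ (3 * ((expY w).toAdd + k.toAdd)) := by
  have : ((w, k) : F2Z) = (w, 1) * z ^ k.toAdd := by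
    ext1
    · simp [z]
    · simp [z, ← ofAdd_zsmul]
  rw [this, map_mul, map_zpow, Subgroup.coe_mul, Subgroup.coe_zpow, toH_inl_coe, toH_z_coe,
    mul_add, zpow_add, mul_assoc]
  congr 2
  rw [zpow_mul]
  norm_cast

theorem toH_injective : Function.Injective toH := by
  rw [injective_iff_map_eq_one]
  rintro ⟨w, k⟩ h
  have h := congrArg Subtype.val h
  rw [toH_coe, Subgroup.coe_one] at h
  set m := (expY w).toAdd + k.toAdd with hm
  have hs := congrArg toSemi h
  rw [map_mul, toSemi_freeToGamma, map_zpow, toSemi_a, map_one] at hs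
  -- Under the projection to ℤ, a³ᵐ becomes -6m and the free part vanishes.
  have hr : m = 0 := by
    have hr := congrArg SemidirectProduct.rightHom hs
    simp only [map_mul, map_zpow, map_inv, map_pow, map_one, xSemi, tSemi,
      SemidirectProduct.rightHom_inl, SemidirectProduct.rightHom_inr] at hr
    have hr := congrArg Multiplicative.toAdd hr
    simpa using hr
  rw [hr] at hs
  have hw : w = 1 := by
    apply SemidirectProduct.inl_injective (φ := zpowersHom _ freeAut)
    simpa using hs
  subst hw
  have : k.toAdd = 0 := by simpa [hr] using hm.symm
  exact Prod.ext rfl this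

/-! ### Transport of the cone to F₂ × ℤ -/

/-- The isomorphism `H ≃ F₂ × ℤ` with `a b² ↦ x`, `a² b² a² ↦ y`, `a³ ↦ z`. -/
noncomputable def equivF2Z : H ≃* F2Z :=
  (MulEquiv.ofBijective toH ⟨toH_injective, toH_surjective⟩).symm

theorem equivF2Z_eq_iff {h : H} {t : F2Z} : equivF2Z h = t ↔ toH t = h := by
  rw [equivF2Z, MulEquiv.symm_apply_eq]
  exact eq_comm

theorem map_closure_coneH :
    (Subsemigroup.closure (Set.range coneH)).map (equivF2Z : H →ₙ* F2Z) =
      Subsemigroup.closure (Set.range coneF2Z) := by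
  rw [MulHom.map_mclosure, ← Set.range_comp]
  congr 2
  funext i
  exact equivF2Z_eq_iff.mpr (toH_coneF2Z i)

theorem mem_closure_coneF2Z_iff (t : F2Z) :
    t ∈ Subsemigroup.closure (Set.range coneF2Z) ↔
      toH t ∈ Subsemigroup.closure (Set.range coneH) := by
  rw [← map_closure_coneH]
  constructor
  · rintro ⟨h, hh, e⟩
    rwa [equivF2Z_eq_iff.mp e]
  · exact fun h => ⟨toH t, h, equivF2Z_eq_iff.mpr rfl⟩

/-- The exponent sum of the first generator. -/
def expX : FreeGroup (Fin 2) →* Multiplicative ℤ := FreeGroup.lift ![Multiplicative.ofAdd 1, 1]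

/-- The exponent sums of x, y and z already separate the seven elements. -/
theorem coneF2Z_injective : Function.Injective coneF2Z := by
  let e : F2Z → ℤ × ℤ × ℤ := fun t => ((expX t.1).toAdd, (expY t.1).toAdd, t.2.toAdd)
  have he : e ∘ coneF2Z =
      ![(1, 0, 0), (1, 1, -1), (0, 1, -1), (-1, 0, 0), (-1, -1, 2), (0, -1, 2), (0, 0, -1)] := by
    funext i
    fin_cases i <;> simp [e, coneF2Z, expX, expY, x, y, z]
  refine Function.Injective.of_comp (f := e) ?_
  rw [he]
  decide

end LeftOrderF2Z

theorem corollary1p3 :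
    -- `F₂ × ℤ` has a left order whose positive cone is the subsemigroup generated by
    -- seven explicit, pairwise distinct elements
    (∃ r : LeftOrderF2Z.F2Z → LeftOrderF2Z.F2Z → Prop,
      LeftOrderF2Z.IsLeftOrder r ∧
      LeftOrderF2Z.positiveCone r =
        (Subsemigroup.closure (Set.range LeftOrderF2Z.coneF2Z) : Set LeftOrderF2Z.F2Z)) ∧
    Function.Injective LeftOrderF2Z.coneF2Z ∧
    -- `Γ₂ ≅ B₃` via `a ↦ σ₁ σ₂`, `b ↦ σ₂⁻¹`
    (∃ e : LeftOrderF2Z.Gamma ≃* LeftOrderF2Z.B3,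
      e LeftOrderF2Z.a = LeftOrderF2Z.σ₁ * LeftOrderF2Z.σ₂ ∧
      e LeftOrderF2Z.b = LeftOrderF2Z.σ₂⁻¹) ∧
    -- `φ(a) = 4`, `φ(b) = 1` modulo `6`
    LeftOrderF2Z.phi LeftOrderF2Z.a = Multiplicative.ofAdd (4 : ZMod 6) ∧
    LeftOrderF2Z.phi LeftOrderF2Z.b = Multiplicative.ofAdd (1 : ZMod 6) ∧
    -- the kernel `H` of `φ` has index `6` and is generated by `a b²`, `a² b² a²`, `a³`
    LeftOrderF2Z.H.index = 6 ∧
    Subgroup.closure (Set.range LeftOrderF2Z.genGamma) = LeftOrderF2Z.H ∧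
    -- `H` has a left order whose positive cone is generated as a semigroup by the seven
    -- elements `Y`, and this cone is the intersection of `H` with the semigroup `⟨a, b⟩⁺`
    (∃ s : LeftOrderF2Z.H → LeftOrderF2Z.H → Prop,
      LeftOrderF2Z.IsLeftOrder s ∧
      LeftOrderF2Z.positiveCone s =
        (Subsemigroup.closure (Set.range LeftOrderF2Z.coneH) : Set LeftOrderF2Z.H) ∧
      LeftOrderF2Z.positiveCone s =
        {h : LeftOrderF2Z.H | (h : LeftOrderF2Z.Gamma) ∈
          Subsemigroup.closure ({LeftOrderF2Z.a, LeftOrderF2Z.b} : Set LeftOrderF2Z.Gamma)}) ∧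
    -- the explicit isomorphism `ψ : H ≅ F₂ × ℤ`, and the image of `Y` under it
    (∃ ψ : LeftOrderF2Z.H ≃* LeftOrderF2Z.F2Z,
      ψ (LeftOrderF2Z.genH 0) = LeftOrderF2Z.x ∧
      ψ (LeftOrderF2Z.genH 1) = LeftOrderF2Z.y ∧
      ψ (LeftOrderF2Z.genH 2) = LeftOrderF2Z.z ∧
      ∀ i : Fin 7, ψ (LeftOrderF2Z.coneH i) = LeftOrderF2Z.coneF2Z i) := by

  refine ⟨?_, LeftOrderF2Z.coneF2Z_injective,
    ⟨LeftOrderF2Z.gammaEquivB3, LeftOrderF2Z.gammaEquivB3_a, LeftOrderF2Z.gammaEquivB3_b⟩,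
    LeftOrderF2Z.phi_a, LeftOrderF2Z.phi_b, LeftOrderF2Z.index_H, LeftOrderF2Z.closure_genGamma,
    ?_, ⟨LeftOrderF2Z.equivF2Z, ?_, ?_, ?_, fun i => ?_⟩⟩
  · refine LeftOrderF2Z.exists_leftOrder _ ?_ fun t => ?_
    · rw [LeftOrderF2Z.mem_closure_coneF2Z_iff, map_one]
      exact LeftOrderF2Z.one_notMem_closure_coneH
    · rw [LeftOrderF2Z.mem_closure_coneF2Z_iff, LeftOrderF2Z.mem_closure_coneF2Z_iff, map_inv,
        ← map_eq_one_iff _ LeftOrderF2Z.toH_injective]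
      exact LeftOrderF2Z.closure_coneH_total _
  · obtain ⟨s, hs, e⟩ := LeftOrderF2Z.exists_leftOrder _ LeftOrderF2Z.one_notMem_closure_coneH
      LeftOrderF2Z.closure_coneH_total
    exact ⟨s, hs, e, e.trans (Set.ext LeftOrderF2Z.mem_closure_coneH_iff)⟩
  · exact LeftOrderF2Z.equivF2Z_eq_iff.mpr LeftOrderF2Z.toH_x
  · exact LeftOrderF2Z.equivF2Z_eq_iff.mpr LeftOrderF2Z.toH_y
  · exact LeftOrderF2Z.equivF2Z_eq_iff.mpr LeftOrderF2Z.toH_z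
  · exact LeftOrderF2Z.equivF2Z_eq_iff.mpr (LeftOrderF2Z.toH_coneF2Z i)
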